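/- Let $0<q<1$. Let ${\cal H}$ be the Hilbert space with orthonormal basis $e_{ij}^{(n)}$, $n\in\frac12{\mathbb N}$, $i,j\in\{-n,-n+1,\dots,n\}$, and let $\beta$ be the bounded operator (one of the standard generators of $SU_q(2)$ in the representation ${\cal H}$) $$\beta\, e_{ij}^{(n)} = b_+(n,i,j)\, e_{i+\frac12,\,j-\frac12}^{(n+\frac12)} + b_-(n,i,j)\, e_{i+\frac12,\,j-\frac12}^{(n-\frac12)},$$ $$b_+(n,i,j)=-q^{n+j}\,\frac{(1-q^{2n-2j+2})^{1/2}(1-q^{2n+2i+2})^{1/2}}{(1-q^{4n+2})^{1/2}(1-q^{4n+4})^{1/2}},\qquad b_-(n,i,j)=q^{n+i}\,\frac{(1-q^{2n+2j})^{1/2}(1-q^{2n-2i})^{1/2}}{(1-q^{4n})^{1/2}(1-q^{4n+2})^{1/2}},$$ where the second term is $0$ if $i=n$ or $j=-n$. Let $D$ be the self-adjoint diagonal operator with $D e_{ij}^{(n)}=2n\,e_{ij}^{(n)}$ if $i=n$ and $D e_{ij}^{(n)}=-2n\,e_{ij}^{(n)}$ if $i\neq n$. Let $P$ be the orthogonal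 projection on the closed span of the vectors $e_{nj}^{(n)}$, that is, $P=(1+F)/2$ with $F={\rm sign}\,D$ taken to be $1$ on the kernel ${\mathbb C}\,e_{00}^{(0)}$ of $D$; and let $|D|$ be given an arbitrary value $\varepsilon>0$ on this kernel. For a bounded operator $a$ such that $a\,P\,|D|^{-s}$ is of trace class for ${\rm Re}\,s>3$ and $s\mapsto{\rm Trace}(a\,P\,|D|^{-s})$ has a meromorphic continuation to ${\mathbb C}$ that is regular at $s=0$, let $\psi_0(a)=2\,{\rm Trace}(a\,P\,|D|^{-s})_{s=0}$ be twice the value of this continuation at $s=0$. Let $$G(x)=\sum_{n=1}^{\infty}\frac{n\,x^{n}}{1-x^{n}}\qquad(|x|<1).$$ Up to sign and an additive constant, $G$ is the logarithmic derivative of the Dedekind eta function $\eta=x^{1/24}\prod_{n\ge1}(1-x^n)$: with $x=e^{2\pi i\tau}$ and ${\rm Im}\,\tau>0$, $$\frac{1}{\eta}\,\frac{d\eta}{d\tau}=2\pi i\left(\frac1{24}-G(x)\right).$$ **Theorem 6.** For every integer $r\ge 1$ there is a rational function $R_r$, independent of $q$ and $\varepsilon$, whose poles in ${\mathbb C}$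 are all roots of unity, such that for all $q\in\,]0,1[$ and all $\varepsilon>0$ the value $\psi_0((\beta^*\beta)^r)$ is defined and $$\tfrac12\,\psi_0\big((\beta^*\beta)^r\big)=q^{-2r}\left(q^2R_r(q^2)-G(q^2)\right).$$ -/

import Mathlib

namespace SUq2

open Complex

/-- The index set of the orthonormal basis. The vector `e_{ij}^{(n)}` with
`n ∈ {0, 1/2, 1, …}` and `i, j ∈ {-n, -n+1, …, n}` has the label `(N, x, y)` with `N = 2n`,
`x = n + i` and `y = n + j`; thus `N ∈ ℕ` and `x, y ∈ {0, …, N}`. -/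
abbrev Idx : Type := Σ N : ℕ, Fin (N + 1) × Fin (N + 1)

/-- The Hilbert space with orthonormal basis `e_{ij}^{(n)}`. -/
abbrev H : Type := lp (fun _ : Idx => ℂ) 2

/-- The basis vector with label `k`. -/
noncomputable def e (k : Idx) : H := lp.single 2 k (1 : ℂ)

theorem memlp_weighted (σ : Idx ↪ Idx) (w : Idx → ℂ) (C : ℝ) (hC : ∀ k, ‖w k‖ ≤ C) (f : H) :
    Memℓp (fun k => w k * f (σ k)) 2 := by
  have hf : Summable fun k => ‖f (σ k)‖ ^ (2 : ℝ) := by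
    have := (lp.memℓp f).summable (by norm_num)
    simpa [Function.comp_def] using this.comp_injective σ.injective
  refine memℓp_gen ?_
  refine Summable.of_nonneg_of_le (fun k => by positivity) (fun k => ?_) (hf.mul_left (C ^ (2 : ℝ)))
  have h0 : 0 ≤ C := (norm_nonneg _).trans (hC k)
  simp only [ENNReal.toReal_ofNat]
  rw [norm_mul, Real.mul_rpow (norm_nonneg _) (norm_nonneg _)]
  gcongr
  exact hC k

/-- The bounded operator `f ↦ (k ↦ w k * f (σ k))` attached to an injection `σ` of the index set
and a bounded weight `w`; in other words `e_{σ k} ↦ w k • e_k`, and `e_l ↦ 0` for `l` not in the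
range of `σ`. -/
noncomputable def weightedPullback (σ : Idx ↪ Idx) (w : Idx → ℂ) (C : ℝ)
    (hC : ∀ k, ‖w k‖ ≤ C) : H →L[ℂ] H :=
  LinearMap.mkContinuous
    { toFun := fun f => ⟨fun k => w k * f (σ k), memlp_weighted σ w C hC f⟩
      map_add' := fun f g => by
        ext k
        exact mul_add (w k) (f (σ k)) (g (σ k))
      map_smul' := fun c f => by
        ext k
        simp [mul_left_comm] }
    C (fun f => by
      have h0 : 0 ≤ C := (norm_nonneg _).trans (hC ⟨0, 0, 0⟩)
      refine lp.norm_le_of_forall_sum_le (by norm_num) (by positivity) (fun s => ?_)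
      simp only [ENNReal.toReal_ofNat, LinearMap.coe_mk, AddHom.coe_mk]
      rw [Real.mul_rpow h0 (norm_nonneg _)]
      calc ∑ k ∈ s, ‖w k * f (σ k)‖ ^ (2 : ℝ)
          ≤ ∑ k ∈ s, C ^ (2 : ℝ) * ‖f (σ k)‖ ^ (2 : ℝ) := by
            refine Finset.sum_le_sum (fun k _ => ?_)
            rw [norm_mul, Real.mul_rpow (norm_nonneg _) (norm_nonneg _)]
            gcongr
            exact hC k
        _ = C ^ (2 : ℝ) * ∑ k ∈ s.map σ, ‖f k‖ ^ (2 : ℝ) := by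
            rw [Finset.sum_map, Finset.mul_sum]
        _ ≤ C ^ (2 : ℝ) * ‖f‖ ^ (2 : ℝ) := by
            gcongr
            simpa using lp.sum_rpow_le_norm_rpow (p := 2) (by norm_num) f (s.map σ))

theorem weightedPullback_apply (σ : Idx ↪ Idx) (w : Idx → ℂ) (C : ℝ)
    (hC : ∀ k, ‖w k‖ ≤ C) (f : H) (k : Idx) :
    (weightedPullback σ w C hC f : Idx → ℂ) k = w k * f (σ k) := rfl

/-- The coefficient `b_+(n,i,j)`, namely
`-q^(n+j) (1-q^(2n-2j+2))^(1/2) (1-q^(2n+2i+2))^(1/2) / ((1-q^(4n+2))^(1/2) (1-q^(4n+4))^(1/2))`,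
in terms of `N = 2n`, `x = n + i`, `y = n + j`. -/
noncomputable def bPlus (q : ℝ) (N x y : ℕ) : ℝ :=
  -q ^ y * (√(1 - q ^ (2 * (N - y) + 2)) * √(1 - q ^ (2 * x + 2))) /
    (√(1 - q ^ (2 * N + 2)) * √(1 - q ^ (2 * N + 4)))

/-- The coefficient `b_-(n,i,j)`, namely
`q^(n+i) (1-q^(2n+2j))^(1/2) (1-q^(2n-2i))^(1/2) / ((1-q^(4n))^(1/2) (1-q^(4n+2))^(1/2))`,
in terms of `N = 2n`, `x = n + i`, `y = n + j`. -/
noncomputable def bMinus (q : ℝ) (N x y : ℕ) : ℝ :=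
  q ^ x * (√(1 - q ^ (2 * y)) * √(1 - q ^ (2 * (N - x)))) /
    (√(1 - q ^ (2 * N)) * √(1 - q ^ (2 * N + 2)))

/-- `e_{ij}^{(n)} ↦ e_{i+1/2, j-1/2}^{(n+1/2)}` on labels: `(N, x, y) ↦ (N + 1, x + 1, y)`. -/
def shiftX : Idx ↪ Idx where
  toFun k := ⟨k.1 + 1, k.2.1.succ, k.2.2.castSucc⟩
  inj' := by
    rintro ⟨N, x, y⟩ ⟨N', x', y'⟩ h
    have hN : N = N' := by
      have := congrArg Sigma.fst h
      simpa using this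
    subst hN
    simpa using h

/-- `e_{ij}^{(n)} ↦ e_{i-1/2, j+1/2}^{(n+1/2)}` on labels: `(N, x, y) ↦ (N + 1, x, y + 1)`. -/
def shiftY : Idx ↪ Idx where
  toFun k := ⟨k.1 + 1, k.2.1.castSucc, k.2.2.succ⟩
  inj' := by
    rintro ⟨N, x, y⟩ ⟨N', x', y'⟩ h
    have hN : N = N' := by
      have := congrArg Sigma.fst h
      simpa using this
    subst hN
    simpa using h

theorem pow_mul_sqrt_div_le_one (q : ℝ) (h0 : 0 < q) (h1 : q < 1) (m a b c d : ℕ)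
    (hac : a ≤ c) (hbd : b ≤ d) :
    q ^ m * (√(1 - q ^ a) * √(1 - q ^ b)) / (√(1 - q ^ c) * √(1 - q ^ d)) ≤ 1 := by
  have ha : √(1 - q ^ a) ≤ √(1 - q ^ c) :=
    Real.sqrt_le_sqrt (sub_le_sub_left (pow_le_pow_of_le_one h0.le h1.le hac) 1)
  have hb : √(1 - q ^ b) ≤ √(1 - q ^ d) :=
    Real.sqrt_le_sqrt (sub_le_sub_left (pow_le_pow_of_le_one h0.le h1.le hbd) 1)
  refine div_le_one_of_le₀ ?_ (by positivity)
  calc q ^ m * (√(1 - q ^ a) * √(1 - q ^ b)) ≤ 1 * (√(1 - q ^ c) * √(1 - q ^ d)) := by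
        gcongr
        exact pow_le_one₀ h0.le h1.le
    _ = _ := one_mul _

theorem norm_bPlus_le (q : Set.Ioo (0 : ℝ) 1) (k : Idx) :
    ‖((bPlus q k.1 k.2.1 k.2.2 : ℝ) : ℂ)‖ ≤ 1 := by
  have h0 := q.2.1
  have hx := k.2.1.2
  rw [Complex.norm_real, bPlus, neg_mul, neg_div, norm_neg,
    Real.norm_of_nonneg (by positivity)]
  exact pow_mul_sqrt_div_le_one q h0 q.2.2 _ _ _ _ _ (by omega) (by omega)

theorem norm_bMinus_le (q : Set.Ioo (0 : ℝ) 1) (k : Idx) :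
    ‖((bMinus q (k.1 + 1) k.2.1 (k.2.2 + 1) : ℝ) : ℂ)‖ ≤ 1 := by
  have h0 := q.2.1
  have hy := k.2.2.2
  rw [Complex.norm_real, bMinus, Real.norm_of_nonneg (by positivity)]
  exact pow_mul_sqrt_div_le_one q h0 q.2.2 _ _ _ _ _ (by omega) (by omega)

/-- `β_+ e_{ij}^{(n)} = b_+(n,i,j) e_{i+1/2, j-1/2}^{(n+1/2)}`. -/
noncomputable def betaPlus (q : Set.Ioo (0 : ℝ) 1) : H →L[ℂ] H :=
  ContinuousLinearMap.adjoint
    (weightedPullback shiftX (fun k => (bPlus q k.1 k.2.1 k.2.2 : ℝ)) 1 (norm_bPlus_le q))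

/-- `β_- e_{ij}^{(n)} = b_-(n,i,j) e_{i+1/2, j-1/2}^{(n-1/2)}`. -/
noncomputable def betaMinus (q : Set.Ioo (0 : ℝ) 1) : H →L[ℂ] H :=
  weightedPullback shiftY (fun k => (bMinus q (k.1 + 1) k.2.1 (k.2.2 + 1) : ℝ)) 1
    (norm_bMinus_le q)

/-- The generator `β` of the coordinate algebra of `SU_q(2)`, acting in `H`. -/
noncomputable def beta (q : Set.Ioo (0 : ℝ) 1) : H →L[ℂ] H := betaPlus q + betaMinus q

/-- The basis vector with label `(N, x, y)`, and `0` if `(N, x, y)` is not a label. -/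
noncomputable def ev (N x y : ℕ) : H :=
  if h : x < N + 1 ∧ y < N + 1 then e ⟨N, ⟨x, h.1⟩, ⟨y, h.2⟩⟩ else 0

theorem e_apply (k l : Idx) : (e k : Idx → ℂ) l = if l = k then 1 else 0 := by
  classical
  rw [e, lp.coeFn_single, Pi.single_apply]

theorem inner_e (k : Idx) (f : H) : inner ℂ (e k) f = f k := by
  simp [e, lp.inner_single_left]

theorem betaPlus_e (q : Set.Ioo (0 : ℝ) 1) (k : Idx) :
    betaPlus q (e k) = ((bPlus q k.1 k.2.1 k.2.2 : ℝ) : ℂ) • e (shiftX k) := by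
  ext l
  rw [← inner_e, betaPlus, ContinuousLinearMap.adjoint_inner_right, ← inner_conj_symm, inner_e,
    weightedPullback_apply, e_apply, lp.coeFn_smul, Pi.smul_apply, e_apply]
  by_cases h : shiftX k = l
  · simp [h]
  · simp [h, Ne.symm h]

/-- The formula for `β` on the basis:
`β e_{ij}^{(n)} = b_+ e_{i+1/2, j-1/2}^{(n+1/2)} + b_- e_{i+1/2, j-1/2}^{(n-1/2)}`. -/
theorem beta_ev (q : Set.Ioo (0 : ℝ) 1) (N x y : ℕ) (hx : x ≤ N) (hy : y ≤ N) :
    beta q (ev N x y) = ((bPlus q N x y : ℝ) : ℂ) • ev (N + 1) (x + 1) y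
      + ((bMinus q N x y : ℝ) : ℂ) • ev (N - 1) x (y - 1) := by
  have hk : ev N x y = e ⟨N, ⟨x, by omega⟩, ⟨y, by omega⟩⟩ :=
    dif_pos (by omega)
  have hp : ev (N + 1) (x + 1) y = e (shiftX ⟨N, ⟨x, by omega⟩, ⟨y, by omega⟩⟩) :=
    dif_pos (by omega)
  rw [beta, _root_.add_apply, hk, betaPlus_e, hp]
  congr 1
  ext l
  rw [betaMinus, weightedPullback_apply, e_apply, lp.coeFn_smul, Pi.smul_apply, smul_eq_mul]
  obtain ⟨M, u, v⟩ := l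
  by_cases h : shiftY ⟨M, u, v⟩ = ⟨N, ⟨x, by omega⟩, ⟨y, by omega⟩⟩
  · rw [if_pos h, mul_one]
    have h1 : M + 1 = N := congrArg Sigma.fst h
    subst h1
    have h2 : u.castSucc = ⟨x, by omega⟩ ∧ v.succ = ⟨y, by omega⟩ :=
      Prod.mk.inj (eq_of_heq (Sigma.mk.inj h).2)
    have h3 : (u : ℕ) = x := by simpa using congrArg Fin.val h2.1
    have h4 : (v : ℕ) + 1 = y := by simpa using congrArg Fin.val h2.2
    subst h3 h4
    have hl : ev (M + 1 - 1) u (v + 1 - 1) = e ⟨M, u, v⟩ := dif_pos ⟨u.2, v.2⟩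
    rw [hl, e_apply, if_pos rfl, mul_one]
  · rw [if_neg h, mul_zero]
    by_cases hxy : x < N ∧ 0 < y
    · obtain ⟨N, rfl⟩ : ∃ N', N = N' + 1 := ⟨N - 1, by omega⟩
      obtain ⟨y, rfl⟩ : ∃ y', y = y' + 1 := ⟨y - 1, by omega⟩
      have hl : ev (N + 1 - 1) x (y + 1 - 1) = e ⟨N, ⟨x, by omega⟩, ⟨y, by omega⟩⟩ :=
        dif_pos (by omega)
      rw [hl, e_apply, if_neg, mul_zero]
      intro hM
      exact h (by rw [hM]; rfl)
    · have hb : bMinus q N x y = 0 := by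
        rcases not_and_or.mp hxy with hx' | hy'
        · obtain rfl : x = N := by omega
          simp [bMinus]
        · obtain rfl : y = 0 := by omega
          simp [bMinus]
      simp [hb]

/-- The sign `2 δ_0(n - i) - 1` of `D` on `e_{ij}^{(n)}`: it is `1` if `i = n` (in particular on
the kernel of `D`, spanned by `e_{00}^{(0)}`), and `-1` otherwise. -/
def fEigen (k : Idx) : ℝ :=
  if (k.2.1 : ℕ) = k.1 then 1 else -1

/-- The eigenvalue `(2 δ_0(n - i) - 1) 2n` of `D` on `e_{ij}^{(n)}`. -/
def dEigen (k : Idx) : ℝ := fEigen k * k.1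

open scoped Classical in
/-- The diagonal operator with `e_k ↦ d k • e_k`, for a bounded `d` (and `0` if `d` is not
bounded). -/
noncomputable def diagOp (d : Idx → ℂ) : H →L[ℂ] H :=
  if h : ∃ C : ℝ, ∀ k, ‖d k‖ ≤ C then
    weightedPullback (Function.Embedding.refl Idx) d h.choose h.choose_spec
  else 0

theorem diagOp_e (d : Idx → ℂ) (h : ∃ C : ℝ, ∀ k, ‖d k‖ ≤ C) (k : Idx) :
    diagOp d (e k) = d k • e k := by
  ext l
  rw [diagOp, dif_pos h, weightedPullback_apply, lp.coeFn_smul, Pi.smul_apply, smul_eq_mul,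
    Function.Embedding.refl_apply, e_apply]
  by_cases hl : l = k <;> simp [hl]

/-- The operator `F = sign D`. -/
noncomputable def F : H →L[ℂ] H := diagOp (fun k => (fEigen k : ℂ))

/-- The projection `P = (1 + F) / 2`. -/
noncomputable def P : H →L[ℂ] H := (1 / 2 : ℂ) • (1 + F)

/-- The eigenvalue of `|D|` on `e_k`, where the value on the kernel of `D` is replaced by an
arbitrary number `ε > 0`. -/
noncomputable def absDEigen (ε : ℝ) (k : Idx) : ℝ :=
  if dEigen k = 0 then ε else |dEigen k|

/-- The complex power `|D|^{-s}`, which is bounded for `Re s ≥ 0`. -/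
noncomputable def absDPow (ε : ℝ) (s : ℂ) : H →L[ℂ] H :=
  diagOp (fun k => (absDEigen ε k : ℂ) ^ (-s))

/-- Hilbert-Schmidt operators in `H`. -/
def IsHilbertSchmidt (T : H →L[ℂ] H) : Prop := Summable fun k => ‖T (e k)‖ ^ 2

/-- Trace class operators in `H`: the products of two Hilbert-Schmidt operators. -/
def IsTraceClass (T : H →L[ℂ] H) : Prop :=
  ∃ A B : H →L[ℂ] H, IsHilbertSchmidt A ∧ IsHilbertSchmidt B ∧ T = A * B

/-- The trace of a trace class operator. -/
noncomputable def trace (T : H →L[ℂ] H) : ℂ := ∑' k, inner ℂ (e k) (T (e k))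

/-- `Z` is the meromorphic continuation to `ℂ` of `s ↦ Trace (a P |D|^{-s})`, where `a P |D|^{-s}`
is of trace class for `Re s > 3`, and `Z` has no pole at `s = 0`. -/
structure IsEtaZeta (ε : ℝ) (a : H →L[ℂ] H) (Z : ℂ → ℂ) : Prop where
  meromorphic : Meromorphic Z
  analyticAt_zero : AnalyticAt ℂ Z 0
  isTraceClass : ∀ s : ℂ, 3 < s.re → IsTraceClass (a * P * absDPow ε s)
  eq_trace : ∀ s : ℂ, 3 < s.re → Z s = trace (a * P * absDPow ε s)

open scoped Classical in
/-- The `η`-cochain `ψ_0(a) = 2 Trace (a P |D|^{-s})_{s = 0}`. -/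
noncomputable def psi0 (ε : ℝ) (a : H →L[ℂ] H) : ℂ :=
  if h : ∃ Z, IsEtaZeta ε a Z then 2 * h.choose 0 else 0

/-- The value at `0` does not depend on the choice of the continuation. -/
theorem psi0_eq {ε : ℝ} {a : H →L[ℂ] H} {Z : ℂ → ℂ} (hZ : IsEtaZeta ε a Z) :
    psi0 ε a = 2 * Z 0 := by
  have h : ∃ Z, IsEtaZeta ε a Z := ⟨Z, hZ⟩
  rw [psi0, dif_pos h]
  congr 1
  obtain ⟨Y, hY, hYe⟩ : ∃ Y, IsEtaZeta ε a Y ∧ h.choose = Y := ⟨_, h.choose_spec, rfl⟩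
  rw [hYe]
  have hm : MeromorphicOn (Y - Z) Set.univ := fun z _ =>
    (hY.meromorphic z).sub (hZ.meromorphic z)
  have h4 : meromorphicOrderAt (Y - Z) 4 = ⊤ := by
    rw [meromorphicOrderAt_eq_top_iff]
    refine Filter.Eventually.filter_mono nhdsWithin_le_nhds ?_
    have ho : IsOpen {s : ℂ | 3 < s.re} := isOpen_lt continuous_const Complex.continuous_re
    filter_upwards [ho.mem_nhds (show (3 : ℝ) < (4 : ℂ).re by norm_num)] with s hs
    simp [hY.eq_trace s hs, hZ.eq_trace s hs]
  have h0 : meromorphicOrderAt (Y - Z) 0 = ⊤ := by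
    by_contra hne
    exact hm.meromorphicOrderAt_ne_top_of_isPreconnected isPreconnected_univ
      (Set.mem_univ _) (Set.mem_univ _) hne h4
  have ha : AnalyticAt ℂ (Y - Z) 0 := hY.analyticAt_zero.sub hZ.analyticAt_zero
  rw [meromorphicOrderAt_eq_top_iff] at h0
  have := (ha.frequently_zero_iff_eventually_zero.mp h0.frequently).self_of_nhds
  exact sub_eq_zero.mp this

/-- The function `G(x) = ∑_{n ≥ 1} n x^n / (1 - x^n)`, for `|x| < 1`. -/
noncomputable def G (x : ℂ) : ℂ := ∑' n : ℕ, ((n : ℂ) + 1) * x ^ (n + 1) / (1 - x ^ (n + 1))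

end SUq2

/-! Put x = q², and label e_{nj}^{(n)} by `(N, N, y)` with N = 2n, y = n + j. On these vectors β
reduces to its b_+ term and leads to `(N + 1, N + 1, y)`. Since β is normal, (β*β)^(r+1) = β*(β*β)^r
β, so the diagonal coefficient of (β*β)^r is a product of r values of b_+², that is, a quotient of
x-Pochhammer symbols (`inner_pow_ev`).

The sum over y, `momentSum x r N`, tends to K = 1/(1 - x^r) exponentially fast; let d_r(N) be the
difference. Hence the trace is K ζ(s) plus an entire function, and its value at 0 is K(1 + ζ(0)) + ∑
d_r(N) = K/2 + ∑ d_r(N) (`zetaContinuation_zero`). The number ε enters only through ε^(-s), which is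
1 at s = 0.

For r = 1 the d_1(N) are, up to the factor -1/x, the terms of the Lambert series G(x) from the
second one on (`deviation_one`). For larger r a q-Vandermonde summation shows that x^(r+1) d_(r+1) -
x^r d_r is a telescoping difference in N (`deviation_succ`). So x^r ∑ d_r changes with r only by a
rational function whose denominator is a product of factors 1 - x^k: the transcendental part is -G
for every r, and the poles are roots of unity.

The eta identity is separate: it is the termwise logarithmic derivative of the product. -/

/-! ### The eta function and the meromorphy of ζ. -/

open ModularForm EisensteinSeries in
theorem ModularForm.logDeriv_eta_eq_lambert (τ : ℂ) (hτ : 0 < τ.im) :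
    logDeriv ModularForm.eta τ =
      2 * Real.pi * Complex.I *
        (1 / 24 - SUq2.G (Complex.exp (2 * Real.pi * Complex.I * τ))) := by
  have hz : τ ∈ UpperHalfPlane.upperHalfPlaneSet := hτ
  have hd : logDeriv eta τ = logDeriv (Function.Periodic.qParam 24) τ +
      logDeriv (fun z => ∏' n, (1 - eta_q n z)) τ := by
    unfold eta
    rw [logDeriv_mul _ (Function.Periodic.qParam_ne_zero _) (eta_tprod_ne_zero hz) (by fun_prop)
      (differentiableAt_eta_tprod hz)]
  have HG := logDeriv_tprod_eq_tsum UpperHalfPlane.isOpen_upperHalfPlaneSet hz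
    (one_sub_eta_q_ne_zero · hz) (by fun_prop) (summable_logDeriv_one_sub_eta_q hz)
    multipliableLocallyUniformlyOn_eta (eta_tprod_ne_zero hz)
  have hG : ∑' n : ℕ, ((n : ℂ) + 1) * (-eta_q n τ) / (1 - eta_q n τ) =
      -SUq2.G (Complex.exp (2 * Real.pi * Complex.I * τ)) := by
    rw [SUq2.G, ← tsum_neg]
    refine tsum_congr fun n => ?_
    rw [eta_q_eq_pow]
    ring
  rw [hd, logDeriv_qParam, HG, tsum_logDeriv_eta_q, hG]
  push_cast
  ring

/-- Only s = 1 needs an argument: near it ζ is the completed zeta function, with explicit polar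
part, times the entire function 1/Γ_ℝ. -/
theorem meromorphic_riemannZeta : Meromorphic riemannZeta := by
  intro s
  by_cases hs : s = 1
  · have h : (fun s : ℂ => (completedRiemannZeta₀ s - 1 / s - 1 / (1 - s)) * (Complex.Gammaℝ s)⁻¹)
        =ᶠ[nhdsWithin s {s}ᶜ] riemannZeta := by
      refine Filter.Eventually.filter_mono nhdsWithin_le_nhds ?_
      filter_upwards [isOpen_ne.mem_nhds (show s ≠ 0 by simp [hs])] with z hz
      rw [riemannZeta_def_of_ne_zero hz, completedRiemannZeta_eq, ← div_eq_mul_inv]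
    refine MeromorphicAt.congr ?_ h
    have h1 : MeromorphicAt completedRiemannZeta₀ s :=
      (differentiable_completedZeta₀.analyticAt s).meromorphicAt
    have h2 : MeromorphicAt (fun s => (Complex.Gammaℝ s)⁻¹) s :=
      (Complex.differentiable_Gammaℝ_inv.analyticAt s).meromorphicAt
    fun_prop
  · exact (analyticOn_riemannZeta s hs).meromorphicAt

namespace SUq2

/-! ### Moments and their level sums: q-Pochhammer identities. -/

theorem one_sub_pow_ne_zero {x : ℂ} (hx : ‖x‖ < 1) {n : ℕ} (hn : n ≠ 0) : 1 - x ^ n ≠ 0 := by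
  intro h
  have h1 : ‖x ^ n‖ = 1 := by rw [← sub_eq_zero.mp h]; simp
  rw [norm_pow] at h1
  exact (pow_lt_one₀ (norm_nonneg x) hx hn).ne h1

/-- The `r`-th moment of the spectral measure of `β*β` at the basis vector with label
`(m + y, m + y, y)`, as a function of `x = q^2`. -/
noncomputable def moment (x : ℂ) (r m y : ℕ) : ℂ :=
  x ^ (y * r) * ∏ t ∈ Finset.range r, (1 - x ^ (m + 1 + t)) / (1 - x ^ (m + y + 2 + t))

theorem moment_succ (x : ℂ) (r m y : ℕ) :
    moment x (r + 1) m y =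
      x ^ y * (1 - x ^ (m + 1)) / (1 - x ^ (m + y + 2)) * moment x r (m + 1) y := by
  rw [moment, moment, Finset.prod_range_succ']
  have h : ∏ k ∈ Finset.range r, (1 - x ^ (m + 1 + (k + 1))) / (1 - x ^ (m + y + 2 + (k + 1))) =
      ∏ t ∈ Finset.range r, (1 - x ^ (m + 1 + 1 + t)) / (1 - x ^ (m + 1 + y + 2 + t)) :=
    Finset.prod_congr rfl fun k _ => by
      rw [show m + 1 + (k + 1) = m + 1 + 1 + k by ring,
        show m + y + 2 + (k + 1) = m + 1 + y + 2 + k by ring]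
  rw [h]
  ring

/-- The sum of the `r`-th moments over the basis vectors with labels `(N, N, y)`. -/
noncomputable def momentSum (x : ℂ) (r N : ℕ) : ℂ :=
  ∑ y ∈ Finset.range (N + 1), moment x r (N - y) y

/-- The sum `∑_y x^(y s) (x^(N-y+1); x)_r`. -/
noncomputable def numSum (x : ℂ) (r s N : ℕ) : ℂ :=
  ∑ y ∈ Finset.range (N + 1), x ^ (y * s) * ∏ t ∈ Finset.range r, (1 - x ^ (N - y + 1 + t))

/-- The `x`-Pochhammer symbol `(x^(N+2); x)_r`. -/
noncomputable def denProd (x : ℂ) (r N : ℕ) : ℂ := ∏ t ∈ Finset.range r, (1 - x ^ (N + 2 + t))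

theorem denProd_ne_zero {x : ℂ} (hx : ‖x‖ < 1) (r N : ℕ) : denProd x r N ≠ 0 :=
  Finset.prod_ne_zero_iff.mpr fun t _ => one_sub_pow_ne_zero hx (by omega)

theorem momentSum_eq (x : ℂ) (r N : ℕ) : momentSum x r N = numSum x r r N / denProd x r N := by
  rw [momentSum, numSum, denProd, Finset.sum_div]
  refine Finset.sum_congr rfl fun y hy => ?_
  have hy' : y ≤ N := by simpa [Nat.lt_succ_iff] using hy
  rw [moment, Finset.prod_div_distrib, mul_div_assoc, Nat.sub_add_cancel hy']

/-- The term y = 0 is split off; the others shift to level N. -/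
theorem numSum_succ (x : ℂ) (r s N : ℕ) :
    numSum x r s (N + 1) = denProd x r N + x ^ s * numSum x r s N := by
  rw [numSum, Finset.sum_range_succ', numSum, denProd, Finset.mul_sum, add_comm]
  congr 1
  · simp
  · refine Finset.sum_congr rfl fun y _ => ?_
    rw [show N + 1 - (y + 1) = N - y by omega]
    ring

theorem denProd_mul (x : ℂ) (r N : ℕ) :
    denProd x r N * (1 - x ^ (N + 2 + r)) = (1 - x ^ (N + 2)) * denProd x r (N + 1) := by
  rw [denProd, ← Finset.prod_range_succ (fun t => 1 - x ^ (N + 2 + t)), Finset.prod_range_succ',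
    denProd, mul_comm]
  congr 1
  exact Finset.prod_congr rfl fun k _ => by rw [show N + 2 + (k + 1) = N + 1 + 2 + k by ring]

theorem denProd_succ (x : ℂ) (r N : ℕ) :
    denProd x (r + 1) N = denProd x r N * (1 - x ^ (N + 2 + r)) :=
  Finset.prod_range_succ _ _

/-- A `q`-Vandermonde summation. -/
theorem numSum_succ_mul (x : ℂ) (r N : ℕ) :
    numSum x r (r + 1) N * (1 - x ^ (r + 1)) = (1 - x ^ (N + 1)) * denProd x r N := by
  induction N with
  | zero =>
    have h : numSum x r (r + 1) 0 * (1 - x ^ (r + 1)) =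
        ∏ t ∈ Finset.range (r + 1), (1 - x ^ (t + 1)) := by
      rw [Finset.prod_range_succ]
      simp [numSum, add_comm]
    rw [h, Finset.prod_range_succ', denProd, mul_comm]
    simp [add_comm, add_left_comm]
  | succ N ih =>
    -- The induction closes because (1 - x^(r+1)) + x^(r+1) (1 - x^(N+1)) = 1 - x^(N+2+r).
    rw [numSum_succ, add_mul, mul_assoc, ih, ← denProd_mul]
    ring

/-- Expand the last factor 1 - x^(N-y+1+r): its second term lowers the weight x^(y(r+1)) to x^(yr),
up to a factor free of y. The first sum on the right is the one that q-Vandermonde evaluates. -/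
theorem numSum_succ_left (x : ℂ) (r N : ℕ) :
    numSum x (r + 1) (r + 1) N = numSum x r (r + 1) N - x ^ (N + 1 + r) * numSum x r r N := by
  rw [numSum, numSum, numSum, Finset.mul_sum, ← Finset.sum_sub_distrib]
  refine Finset.sum_congr rfl fun y hy => ?_
  obtain ⟨m, rfl⟩ : ∃ m, N = m + y :=
    ⟨N - y, by have := Finset.mem_range.mp hy; omega⟩
  rw [Finset.prod_range_succ, Nat.add_sub_cancel]
  ring

theorem momentSum_zero (x : ℂ) (N : ℕ) : momentSum x 0 N = N + 1 := by
  simp [momentSum, moment]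

theorem momentSum_succ_left {x : ℂ} (hx : ‖x‖ < 1) (r N : ℕ) :
    momentSum x (r + 1) N = ((1 - x ^ (N + 1)) / (1 - x ^ (r + 1)) -
      x ^ (N + 1 + r) * momentSum x r N) / (1 - x ^ (N + 2 + r)) := by
  have h1 := one_sub_pow_ne_zero hx (n := r + 1) (by omega)
  have h2 := one_sub_pow_ne_zero hx (n := N + 2 + r) (by omega)
  have h3 := denProd_ne_zero hx r N
  have h4 := numSum_succ_mul x r N
  rw [← eq_div_iff h1] at h4
  rw [momentSum_eq, momentSum_eq, numSum_succ_left, denProd_succ, h4]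
  field_simp

theorem momentSum_succ_right {x : ℂ} (hx : ‖x‖ < 1) (r N : ℕ) :
    momentSum x r (N + 1) =
      (1 - x ^ (N + 2)) * (1 + x ^ r * momentSum x r N) / (1 - x ^ (N + 2 + r)) := by
  have h1 := one_sub_pow_ne_zero hx (n := N + 2) (by omega)
  have h2 := one_sub_pow_ne_zero hx (n := N + 2 + r) (by omega)
  have h3 := denProd_ne_zero hx r N
  have h4 := denProd_mul x r N
  rw [mul_comm (1 - _), ← div_eq_iff h1] at h4
  rw [momentSum_eq, momentSum_eq, numSum_succ, ← h4]
  field_simp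

/-! ### Deviations of the level sums from their limit: recursion and decay. -/

/-- The deviation of `momentSum` from its limit. -/
noncomputable def deviation (x : ℂ) (r N : ℕ) : ℂ := momentSum x r N - 1 / (1 - x ^ r)

theorem deviation_one {x : ℂ} (hx : ‖x‖ < 1) (N : ℕ) :
    deviation x 1 N = -((N + 2) * x ^ (N + 1) / (1 - x ^ (N + 2))) := by
  have h1 := one_sub_pow_ne_zero hx one_ne_zero
  have h2 := one_sub_pow_ne_zero hx (n := N + 2) (by omega)
  rw [deviation, momentSum_succ_left hx 0, momentSum_zero]
  simp only [zero_add, add_zero, pow_one] at *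
  field_simp
  ring

/-- Both `momentSum x (r + 1) N` and `momentSum x r (N + 1)` are affine in `momentSum x r N`;
eliminating it leaves a difference in N, which telescopes under summation. -/
theorem deviation_succ {x : ℂ} (hx : ‖x‖ < 1) (r : ℕ) (hr : r ≠ 0) (N : ℕ) :
    x ^ (r + 1) * deviation x (r + 1) N =
      x ^ r * deviation x r N -
        x ^ r / (1 - x ^ r) * (deviation x r N - deviation x r (N + 1)) := by
  have h1 := one_sub_pow_ne_zero hx hr
  have h2 := one_sub_pow_ne_zero hx (n := r + 1) (by omega)
  have h3 := one_sub_pow_ne_zero hx (n := N + 2 + r) (by omega)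
  simp only [deviation]
  rw [momentSum_succ_right hx r N, momentSum_succ_left hx r N]
  generalize momentSum x r N = c
  field_simp
  ring

theorem deviation_zero {x : ℂ} (hx : ‖x‖ < 1) (r : ℕ) :
    deviation x r 0 = (1 - x) / (1 - x ^ (r + 1)) - 1 / (1 - x ^ r) := by
  have h2 := one_sub_pow_ne_zero hx (n := r + 1) (by omega)
  have h3 := denProd_ne_zero hx r 0
  -- At N = 0 only y = 0 occurs, so the weight exponent is immaterial and q-Vandermonde applies.
  have h4 : numSum x r r 0 = numSum x r (r + 1) 0 := by simp [numSum]
  have h5 := numSum_succ_mul x r 0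
  rw [← eq_div_iff h2] at h5
  rw [deviation, momentSum_eq, h4, h5]
  field_simp
  simp

/-- The case r = 1 is explicit, and the recursion preserves the bound: passing from N to N + 1 costs
at most a factor 2, since N + 2 ≤ 2(N + 1). -/
theorem exists_norm_deviation_le {x : ℂ} (hx0 : x ≠ 0) (hx : ‖x‖ < 1) {r : ℕ} (hr : 1 ≤ r) :
    ∃ C : ℝ, ∀ N : ℕ, ‖deviation x r N‖ ≤ C * ((N + 1) * ‖x‖ ^ N) := by
  induction r, hr using Nat.le_induction with
  | base =>
    refine ⟨2 / (1 - ‖x‖), fun N => ?_⟩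
    have hx1 : 0 < 1 - ‖x‖ := sub_pos.mpr hx
    have h1 : 1 - ‖x‖ ≤ ‖1 - x ^ (N + 2)‖ := by
      have := norm_sub_norm_le 1 (x ^ (N + 2))
      rw [norm_one, norm_pow] at this
      have h2 : ‖x‖ ^ (N + 2) ≤ ‖x‖ := pow_le_of_le_one (norm_nonneg _) hx.le (by omega)
      linarith
    have h2 : ‖(N : ℂ) + 2‖ ≤ 2 * (N + 1) := by
      have : ‖(N : ℂ) + 2‖ = N + 2 := by
        rw [show (N : ℂ) + 2 = ((N + 2 : ℕ) : ℂ) by push_cast; ring, Complex.norm_natCast]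
        push_cast; ring
      rw [this]
      linarith [(Nat.cast_nonneg N : (0 : ℝ) ≤ N)]
    rw [deviation_one hx, norm_neg, norm_div, norm_mul, norm_pow, div_mul_eq_mul_div]
    refine div_le_div₀ (by positivity) ?_ hx1 h1
    rw [← mul_assoc]
    exact mul_le_mul h2 (pow_le_pow_of_le_one (norm_nonneg _) hx.le (by omega)) (by positivity)
      (by positivity)
  | succ r hr ih =>
    obtain ⟨C, hC⟩ := ih
    have h1 := one_sub_pow_ne_zero hx (n := r) (by omega)
    refine ⟨‖x‖⁻¹ * (C + ‖1 - x ^ r‖⁻¹ * (C + C * 2)), fun N => ?_⟩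
    have hC0 : 0 ≤ C := by simpa using (norm_nonneg _).trans (hC 0)
    have h2 : ‖deviation x r (N + 1)‖ ≤ C * 2 * ((N + 1) * ‖x‖ ^ N) := by
      refine (hC (N + 1)).trans ?_
      rw [mul_assoc C]
      refine mul_le_mul_of_nonneg_left ?_ hC0
      rw [← mul_assoc]
      push_cast
      refine mul_le_mul (by linarith [(Nat.cast_nonneg N : (0 : ℝ) ≤ N)])
        (pow_le_pow_of_le_one (norm_nonneg _) hx.le (by omega)) (by positivity) (by positivity)
    have h3 : deviation x (r + 1) N = x⁻¹ * (deviation x r N -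
        (1 - x ^ r)⁻¹ * (deviation x r N - deviation x r (N + 1))) := by
      have h := deviation_succ hx r (by omega) N
      have h4 : x ^ (r + 1) ≠ 0 := pow_ne_zero _ hx0
      refine mul_left_cancel₀ h4 (h.trans ?_)
      field_simp
      ring
    rw [h3, norm_mul, norm_inv, mul_assoc, add_mul C, mul_assoc, add_mul C]
    refine mul_le_mul_of_nonneg_left ?_ (by positivity)
    refine (norm_sub_le _ _).trans (add_le_add (hC N) ?_)
    rw [norm_mul, norm_inv]
    exact mul_le_mul_of_nonneg_left ((norm_sub_le _ _).trans (add_le_add (hC N) h2))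
      (by positivity)

theorem summable_norm_deviation_mul_pow {x : ℂ} (hx0 : x ≠ 0) (hx : ‖x‖ < 1) {r : ℕ} (hr : 1 ≤ r)
    (p : ℕ) : Summable fun N : ℕ => ‖deviation x r N‖ * (N : ℝ) ^ p := by
  obtain ⟨C, hC⟩ := exists_norm_deviation_le hx0 hx hr
  have h := fun p => summable_pow_mul_geometric_of_norm_lt_one (R := ℝ) p (r := ‖x‖) (by simpa)
  refine Summable.of_nonneg_of_le (fun N => by positivity)
    (fun N => mul_le_mul_of_nonneg_right (hC N) (by positivity))
    ((((h (p + 1)).add (h p)).mul_left C).congr fun N => ?_)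
  ring

theorem summable_deviation {x : ℂ} (hx0 : x ≠ 0) (hx : ‖x‖ < 1) {r : ℕ} (hr : 1 ≤ r) :
    Summable (deviation x r) :=
  .of_norm (by simpa using summable_norm_deviation_mul_pow hx0 hx hr 0)

theorem lseriesSummable_deviation {x : ℂ} (hx0 : x ≠ 0) (hx : ‖x‖ < 1) {r : ℕ} (hr : 1 ≤ r)
    (s : ℂ) : LSeriesSummable (deviation x r) s := by
  -- |N^(-s)| ≤ N^p for N ≥ 1, and exponential decay absorbs any power; hence the Dirichlet series
  -- is entire.
  obtain ⟨p, hp⟩ := exists_nat_ge (-s.re)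
  refine Summable.of_norm_bounded (summable_norm_deviation_mul_pow hx0 hx hr p) fun N => ?_
  rcases Nat.eq_zero_or_pos N with rfl | hN
  · simp only [LSeries.term_zero, norm_zero]
    positivity
  · rw [LSeries.norm_term_eq, if_neg hN.ne', div_eq_mul_inv, ← Real.rpow_neg (by positivity)]
    gcongr
    rw [← Real.rpow_natCast]
    exact Real.rpow_le_rpow_of_exponent_le (by exact_mod_cast hN) hp

theorem analyticAt_lseries_deviation {x : ℂ} (hx0 : x ≠ 0) (hx : ‖x‖ < 1) {r : ℕ} (hr : 1 ≤ r)
    (s : ℂ) : AnalyticAt ℂ (LSeries (deviation x r)) s := by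
  refine LSeries_analyticOnNhd _ s ?_
  have h := (lseriesSummable_deviation hx0 hx hr ((s.re - 1 : ℝ) : ℂ)).abscissaOfAbsConv_le
  refine lt_of_le_of_lt h ?_
  rw [Complex.ofReal_re]
  exact_mod_cast sub_one_lt s.re

/-! ### The regularized sum as a rational function minus the Lambert series. -/

/-- The regularized sum of `momentSum x r`. -/
noncomputable def regularizedSum (x : ℂ) (r : ℕ) : ℂ :=
  1 / 2 * (1 / (1 - x ^ r)) + ∑' N, deviation x r N

theorem summable_lambert {x : ℂ} (hx : ‖x‖ < 1) :
    Summable fun n : ℕ => ((n : ℂ) + 1) * x ^ (n + 1) / (1 - x ^ (n + 1)) := by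
  have h0 := summable_norm_pow_mul_geometric_div_one_sub 1 hx
  have h := (summable_nat_add_iff 1).mpr h0
  exact Summable.congr h fun n => by simp

/-- The sum -x ∑ d_1(N) is G(x) without its first term x/(1 - x); that term and the 1/2 from the
regularization make 3/2. -/
theorem mul_regularizedSum_one {x : ℂ} (hx0 : x ≠ 0) (hx : ‖x‖ < 1) :
    x * regularizedSum x 1 = x * (3 / 2 / (1 - x)) - G x := by
  have h1 : 1 - x ≠ 0 := by simpa using one_sub_pow_ne_zero hx one_ne_zero
  have h2 : G x = x / (1 - x) - x * ∑' N, deviation x 1 N := by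
    rw [G, (summable_lambert hx).tsum_eq_zero_add, ← tsum_mul_left, sub_eq_add_neg (x / _),
      ← tsum_neg]
    congr 1
    · simp
    · refine tsum_congr fun n => ?_
      rw [deviation_one hx]
      push_cast
      ring
  rw [h2, regularizedSum]
  field_simp
  ring

/-- After telescoping only d_(k+1)(0) survives, and it is rational in x. The correction carries a
factor x, as the form x R(x) requires. -/
theorem pow_mul_regularizedSum_succ {x : ℂ} (hx0 : x ≠ 0) (hx : ‖x‖ < 1) (k : ℕ) :
    x ^ (k + 2) * regularizedSum x (k + 2) = x ^ (k + 1) * regularizedSum x (k + 1) +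
      x * ((1 / 2 * (x ^ k * (x - 1) * (1 - x ^ (k + 1))) -
        x ^ k * ((1 - x) * (1 - x ^ (k + 1)) - (1 - x ^ (k + 2)))) /
        ((1 - x ^ (k + 2)) * (1 - x ^ (k + 1)) ^ 2)) := by
  have h1 := one_sub_pow_ne_zero hx (n := k + 1) (by omega)
  have h2 := one_sub_pow_ne_zero hx (n := k + 2) (by omega)
  have hs := summable_deviation hx0 hx (r := k + 1) (by omega)
  have hs1 := (summable_nat_add_iff 1).mpr hs
  have h3 : x ^ (k + 2) * ∑' N, deviation x (k + 2) N =
      x ^ (k + 1) * ∑' N, deviation x (k + 1) N -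
        x ^ (k + 1) / (1 - x ^ (k + 1)) * deviation x (k + 1) 0 := by
    rw [← tsum_mul_left, tsum_congr (deviation_succ hx (k + 1) (by omega)),
      (hs.mul_left _).tsum_sub ((hs.sub hs1).mul_left _), tsum_mul_left, tsum_mul_left,
      hs.tsum_sub hs1, hs.tsum_eq_zero_add]
    ring
  rw [regularizedSum, regularizedSum, mul_add, h3, deviation_zero hx]
  field_simp
  ring

/-- `RatFunc.eval` uses the reduced fraction; it agrees with the naive quotient in the open unit
disc because no root of unity lies there. -/
theorem eval_quotient_add {R : RatFunc ℂ}
    (hR : ∀ z : ℂ, R.denom.eval z = 0 → ∃ k : ℕ, 0 < k ∧ z ^ k = 1) (p d : Polynomial ℂ)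
    (hd : ∀ z : ℂ, d.eval z = 0 → ∃ k : ℕ, 0 < k ∧ z ^ k = 1) :
    ∃ S : RatFunc ℂ, (∀ z : ℂ, S.denom.eval z = 0 → ∃ k : ℕ, 0 < k ∧ z ^ k = 1) ∧
      ∀ z : ℂ, ‖z‖ < 1 →
        S.eval (RingHom.id ℂ) z = R.eval (RingHom.id ℂ) z + p.eval z / d.eval z := by
  set T : RatFunc ℂ := algebraMap _ _ p / algebraMap _ _ d with hT
  have hTd : T.denom ∣ d := RatFunc.denom_div_dvd p d
  have hTr : ∀ z : ℂ, T.denom.eval z = 0 → ∃ k : ℕ, 0 < k ∧ z ^ k = 1 := fun z hz =>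
    hd z (Polynomial.eval_eq_zero_of_dvd_of_eval_eq_zero hTd hz)
  have hroot : ∀ z : ℂ, ‖z‖ < 1 → ¬ ∃ k : ℕ, 0 < k ∧ z ^ k = 1 := fun z hz ⟨k, hk, h⟩ =>
    one_sub_pow_ne_zero hz hk.ne' (by rw [h, sub_self])
  refine ⟨R + T, fun z hz => ?_, fun z hz => ?_⟩
  · have := Polynomial.eval_eq_zero_of_dvd_of_eval_eq_zero (RatFunc.denom_add_dvd R T) hz
    rw [Polynomial.eval_mul, mul_eq_zero] at this
    exact this.elim (hR z) (hTr z)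
  · rw [RatFunc.eval_add _ _ (fun h => hroot z hz (hR z h)) (fun h => hroot z hz (hTr z h))]
    congr 1
    have hd0 : d.eval z ≠ 0 := fun h => hroot z hz (hd z h)
    have hdne : d ≠ 0 := by rintro rfl; simp at hd0
    have hTz : T.denom.eval z ≠ 0 := fun h => hroot z hz (hTr z h)
    rw [RatFunc.eval]
    simp only [Polynomial.eval₂_id]
    rw [div_eq_div_iff hTz hd0]
    rw [← Polynomial.eval_mul, ← Polynomial.eval_mul,
      (RatFunc.num_mul_eq_mul_denom_iff hdne).mpr hT]

theorem exists_ratFunc_regularizedSum {r : ℕ} (hr : 1 ≤ r) :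
    ∃ R : RatFunc ℂ, (∀ z : ℂ, R.denom.eval z = 0 → ∃ k : ℕ, 0 < k ∧ z ^ k = 1) ∧
      ∀ x : ℂ, x ≠ 0 → ‖x‖ < 1 →
        x ^ r * regularizedSum x r = x * R.eval (RingHom.id ℂ) x - G x := by
  induction r, hr using Nat.le_induction with
  | base =>
    obtain ⟨S, hS, hSe⟩ := eval_quotient_add (R := 0) (by simp) (Polynomial.C (3 / 2))
      (1 - Polynomial.X) (fun z hz => ⟨1, one_pos, by
        simp only [Polynomial.eval_sub, Polynomial.eval_one, Polynomial.eval_X] at hz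
        rw [pow_one]; exact (sub_eq_zero.mp hz).symm⟩)
    refine ⟨S, hS, fun x hx0 hx => ?_⟩
    rw [hSe x hx, pow_one, mul_regularizedSum_one hx0 hx]
    simp
  | succ r hr ih =>
    obtain ⟨R, hR, hRe⟩ := ih
    obtain ⟨k, rfl⟩ : ∃ k, r = k + 1 := ⟨r - 1, by omega⟩
    obtain ⟨S, hS, hSe⟩ := eval_quotient_add hR
      (Polynomial.C (1 / 2) * (Polynomial.X ^ k * (Polynomial.X - 1) *
        (1 - Polynomial.X ^ (k + 1))) -
        Polynomial.X ^ k * ((1 - Polynomial.X) * (1 - Polynomial.X ^ (k + 1)) -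
          (1 - Polynomial.X ^ (k + 2))))
      ((1 - Polynomial.X ^ (k + 2)) * (1 - Polynomial.X ^ (k + 1)) ^ 2)
      (fun z hz => by
        simp only [Polynomial.eval_mul, Polynomial.eval_sub, Polynomial.eval_one,
          Polynomial.eval_pow, Polynomial.eval_X, mul_eq_zero, pow_eq_zero_iff two_ne_zero,
          sub_eq_zero] at hz
        exact hz.elim (fun h => ⟨k + 2, by omega, h.symm⟩) (fun h => ⟨k + 1, by omega, h.symm⟩))
    refine ⟨S, hS, fun x hx0 hx => ?_⟩
    rw [show k + 1 + 1 = k + 2 from rfl, pow_mul_regularizedSum_succ hx0 hx k, hRe x hx0 hx,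
      hSe x hx]
    simp only [Polynomial.eval_mul, Polynomial.eval_sub, Polynomial.eval_one,
      Polynomial.eval_pow, Polynomial.eval_X, Polynomial.eval_C]
    ring

/-! ### The adjoint of β and normality. -/

theorem clm_ext_e {S T : H →L[ℂ] H} (h : ∀ k, S (e k) = T (e k)) : S = T := by
  refine lp.ext_continuousLinearMap (by norm_num) fun k => ?_
  ext1
  exact h k

theorem ev_eq {N x y : ℕ} (hx : x ≤ N) (hy : y ≤ N) :
    ev N x y = e ⟨N, ⟨x, Nat.lt_succ_of_le hx⟩, ⟨y, Nat.lt_succ_of_le hy⟩⟩ :=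
  dif_pos ⟨Nat.lt_succ_of_le hx, Nat.lt_succ_of_le hy⟩

/-- The coefficient of `e_{i-1/2, j+1/2}^{(n-1/2)}` in `β* e_{ij}^{(n)}`, in terms of `N = 2n`,
`x = n + i` and `y = n + j`. -/
noncomputable def bPlusStar (q : ℝ) (N x y : ℕ) : ℝ :=
  -q ^ y * (√(1 - q ^ (2 * (N - y))) * √(1 - q ^ (2 * x))) /
    (√(1 - q ^ (2 * N)) * √(1 - q ^ (2 * N + 2)))

theorem bPlusStar_succ (q : ℝ) {N x y : ℕ} (hy : y ≤ N) :
    bPlusStar q (N + 1) (x + 1) y = bPlus q N x y := by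
  rw [bPlusStar, bPlus, show 2 * (N + 1 - y) = 2 * (N - y) + 2 by omega]
  rfl

theorem adjoint_betaMinus_e (q : Set.Ioo (0 : ℝ) 1) (k : Idx) :
    ContinuousLinearMap.adjoint (betaMinus q) (e k) =
      ((bMinus q (k.1 + 1) k.2.1 (k.2.2 + 1) : ℝ) : ℂ) • e (shiftY k) := by
  ext l
  rw [← inner_e, betaMinus, ContinuousLinearMap.adjoint_inner_right, ← inner_conj_symm, inner_e,
    weightedPullback_apply, e_apply, lp.coeFn_smul, Pi.smul_apply, e_apply]
  by_cases h : shiftY k = l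
  · simp [h]
  · simp [h, Ne.symm h]

theorem adjoint_beta_ev (q : Set.Ioo (0 : ℝ) 1) (N x y : ℕ) (hx : x ≤ N) (hy : y ≤ N) :
    ContinuousLinearMap.adjoint (beta q) (ev N x y) =
      ((bPlusStar q N x y : ℝ) : ℂ) • ev (N - 1) (x - 1) y
      + ((bMinus q (N + 1) x (y + 1) : ℝ) : ℂ) • ev (N + 1) x (y + 1) := by
  have hp : ev (N + 1) x (y + 1) = e (shiftY ⟨N, ⟨x, by omega⟩, ⟨y, by omega⟩⟩) :=
    dif_pos (by omega)
  rw [beta, map_add, _root_.add_apply, ev_eq hx hy, adjoint_betaMinus_e, hp]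
  congr 1
  ext l
  rw [betaPlus, ContinuousLinearMap.adjoint_adjoint, weightedPullback_apply, e_apply,
    lp.coeFn_smul, Pi.smul_apply, smul_eq_mul]
  obtain ⟨M, u, v⟩ := l
  by_cases h : shiftX ⟨M, u, v⟩ = ⟨N, ⟨x, by omega⟩, ⟨y, by omega⟩⟩
  · rw [if_pos h, mul_one]
    have h1 : M + 1 = N := congrArg Sigma.fst h
    subst h1
    have h2 : u.succ = ⟨x, by omega⟩ ∧ v.castSucc = ⟨y, by omega⟩ :=
      Prod.mk.inj (eq_of_heq (Sigma.mk.inj h).2)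
    have h3 : (u : ℕ) + 1 = x := by simpa using congrArg Fin.val h2.1
    have h4 : (v : ℕ) = y := by simpa using congrArg Fin.val h2.2
    subst h3 h4
    have hl : ev (M + 1 - 1) (u + 1 - 1) v = e ⟨M, u, v⟩ := dif_pos ⟨u.2, v.2⟩
    rw [hl, e_apply, if_pos rfl, mul_one, bPlusStar_succ _ (Nat.le_of_lt_succ v.2)]
  · rw [if_neg h, mul_zero]
    by_cases hxy : 0 < x ∧ y < N
    · obtain ⟨N, rfl⟩ : ∃ N', N = N' + 1 := ⟨N - 1, by omega⟩
      obtain ⟨x, rfl⟩ : ∃ x', x = x' + 1 := ⟨x - 1, by omega⟩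
      have hl : ev (N + 1 - 1) (x + 1 - 1) y = e ⟨N, ⟨x, by omega⟩, ⟨y, by omega⟩⟩ :=
        dif_pos (by omega)
      rw [hl, e_apply, if_neg, mul_zero]
      intro hM
      exact h (by rw [hM]; rfl)
    · have hb : bPlusStar q N x y = 0 := by
        rcases not_and_or.mp hxy with hx' | hy'
        · obtain rfl : x = 0 := by omega
          simp [bPlusStar]
        · obtain rfl : y = N := by omega
          simp [bPlusStar]
      simp [hb]

theorem bMinus_eq_zero (q : ℝ) {N x y : ℕ} (h : N ≤ x ∨ y = 0) : bMinus q N x y = 0 := by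
  rcases h with h | rfl
  · simp [bMinus, Nat.sub_eq_zero_of_le h]
  · simp [bMinus]

/-- Together with `bMinus_eq_zero`, this makes truncated subtraction in labels harmless: where a
label would leave the index set, its coefficient vanishes. -/
theorem bPlusStar_eq_zero (q : ℝ) {N x y : ℕ} (h : N ≤ y ∨ x = 0) : bPlusStar q N x y = 0 := by
  rcases h with h | rfl
  · simp [bPlusStar, Nat.sub_eq_zero_of_le h]
  · simp [bPlusStar]

theorem sq_sqrt_one_sub_pow {q : ℝ} (h0 : 0 < q) (h1 : q < 1) (n : ℕ) : √(1 - q ^ n) ^ 2 = 1 - q ^ n :=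
  Real.sq_sqrt (sub_nonneg.mpr (pow_le_one₀ h0.le h1.le))

theorem bPlus_sq {q : ℝ} (h0 : 0 < q) (h1 : q < 1) (N x y : ℕ) :
    bPlus q N x y ^ 2 = q ^ (2 * y) * ((1 - q ^ (2 * (N - y) + 2)) * (1 - q ^ (2 * x + 2))) /
      ((1 - q ^ (2 * N + 2)) * (1 - q ^ (2 * N + 4))) := by
  simp only [bPlus, div_pow, mul_pow, sq_sqrt_one_sub_pow h0 h1]
  ring

theorem bPlusStar_sq {q : ℝ} (h0 : 0 < q) (h1 : q < 1) (N x y : ℕ) :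
    bPlusStar q N x y ^ 2 = q ^ (2 * y) * ((1 - q ^ (2 * (N - y))) * (1 - q ^ (2 * x))) /
      ((1 - q ^ (2 * N)) * (1 - q ^ (2 * N + 2))) := by
  simp only [bPlusStar, div_pow, mul_pow, sq_sqrt_one_sub_pow h0 h1]
  ring

theorem bMinus_sq {q : ℝ} (h0 : 0 < q) (h1 : q < 1) (N x y : ℕ) :
    bMinus q N x y ^ 2 = q ^ (2 * x) * ((1 - q ^ (2 * y)) * (1 - q ^ (2 * (N - x)))) /
      ((1 - q ^ (2 * N)) * (1 - q ^ (2 * N + 2))) := by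
  simp only [bMinus, div_pow, mul_pow, sq_sqrt_one_sub_pow h0 h1]
  ring

/-- The diagonal coefficients of `β*β` and `ββ*` agree. -/
theorem diagonal_coeff_eq {q : ℝ} (h0 : 0 < q) (h1 : q < 1) {N x y : ℕ} (hx : x ≤ N) (hy : y ≤ N) :
    bPlus q N x y ^ 2 + bMinus q N x y ^ 2 =
      bPlusStar q N x y ^ 2 + bMinus q (N + 1) x (y + 1) ^ 2 := by
  have hne : ∀ n : ℕ, n ≠ 0 → 1 - q ^ n ≠ 0 := fun n hn =>
    (sub_pos.mpr (pow_lt_one₀ h0.le h1 hn)).ne'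
  rw [bPlus_sq h0 h1, bMinus_sq h0 h1, bMinus_sq h0 h1, bPlusStar_sq h0 h1]
  -- At N = 0 the factor 1 - q^(2N) vanishes, and the coefficients divided by it are 0/0, read as 0.
  rcases Nat.eq_zero_or_pos N with rfl | hN
  · obtain rfl : x = 0 := by omega
    obtain rfl : y = 0 := by omega
    simp
  · have e1 := hne (2 * N) (by omega)
    have e2 := hne (2 * N + 2) (by omega)
    have e3 := hne (2 * N + 4) (by omega)
    obtain ⟨a, rfl⟩ := Nat.exists_eq_add_of_le hx
    obtain ⟨b, hb⟩ := Nat.exists_eq_add_of_le hy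
    rw [show 2 * (x + a + 1) + 2 = 2 * (x + a) + 4 by ring, show x + a + 1 - x = a + 1 by omega,
      show x + a - x = a by omega, show 2 * (x + a + 1) = 2 * (x + a) + 2 by ring,
      show x + a - y = b by omega]
    -- Both sides are q^(2N). This eliminates q^(2b) and leaves a rational identity in q and three
    -- free variables.
    have hq : q ^ (2 * x) * q ^ (2 * a) = q ^ (2 * y) * q ^ (2 * b) := by
      rw [← pow_add, ← pow_add]; congr 1; omega
    have hN' : q ^ (2 * (x + a)) = q ^ (2 * x) * q ^ (2 * a) := by rw [← pow_add, mul_add]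
    rw [show 2 * (a + 1) = 2 * a + 2 by ring, show 2 * (y + 1) = 2 * y + 2 by ring]
    have p2 : ∀ n, q ^ (n + 2) = q ^ n * q ^ 2 := fun n => pow_add q n 2
    have p4 : ∀ n, q ^ (n + 4) = q ^ n * q ^ 4 := fun n => pow_add q n 4
    rw [p2 (2 * (x + a)), p4 (2 * (x + a)), hN']
    rw [hN'] at e1
    rw [p2, hN'] at e2
    rw [p4, hN'] at e3
    have hY : q ^ (2 * y) ≠ 0 := (pow_pos h0 _).ne'
    have hB := eq_div_of_mul_eq hY ((mul_comm _ _).trans hq.symm)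
    rw [p2 (2 * b), p2 (2 * x), p2 (2 * y), p2 (2 * a), hB]
    generalize q ^ (2 * x) = X at *
    generalize q ^ (2 * y) = Y at *
    generalize q ^ (2 * a) = A at *
    field_simp
    ring

theorem coeff_up_eq (q : ℝ) {N x y : ℕ} (hx : x ≤ N) (hy : y ≤ N) :
    bPlus q N x y * bMinus q (N + 2) (x + 1) (y + 1) =
      bMinus q (N + 1) x (y + 1) * bPlus q (N + 1) x (y + 1) := by
  rw [bPlus, bPlus, bMinus, bMinus, show N + 2 - (x + 1) = N + 1 - x by omega,
    show 2 * (N + 1 - (y + 1)) = 2 * (N - y) by omega, show 2 * (N + 2) = 2 * N + 4 by ring,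
    show 2 * (N + 1) = 2 * N + 2 by ring]
  ring

theorem coeff_down_eq (q : ℝ) {N x y : ℕ} (hx : x ≤ N) (hy : y ≤ N) :
    bMinus q (N + 2) (x + 1) (y + 1) * bPlusStar q (N + 1) (x + 1) y =
      bPlusStar q (N + 2) (x + 1) (y + 1) * bMinus q (N + 1) x (y + 1) := by
  rw [bPlusStar, bPlusStar, bMinus, bMinus, show N + 2 - (x + 1) = N + 1 - x by omega,
    show N + 2 - (y + 1) = N + 1 - y by omega]
  ring

theorem adjoint_beta_beta_ev (q : Set.Ioo (0 : ℝ) 1) {N x y : ℕ} (hx : x ≤ N) (hy : y ≤ N) :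
    ContinuousLinearMap.adjoint (beta q) (beta q (ev N x y)) =
      ((bPlus q N x y ^ 2 + bMinus q N x y ^ 2 : ℝ) : ℂ) • ev N x y +
      ((bPlus q N x y * bMinus q (N + 2) (x + 1) (y + 1) : ℝ) : ℂ) •
        ev (N + 2) (x + 1) (y + 1) +
      ((bMinus q N x y * bPlusStar q (N - 1) x (y - 1) : ℝ) : ℂ) •
        ev (N - 2) (x - 1) (y - 1) := by
  rw [beta_ev q N x y hx hy, map_add, map_smul, map_smul,
    adjoint_beta_ev q (N + 1) (x + 1) y (by omega) (by omega), bPlusStar_succ _ hy]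
  by_cases h : N ≤ x ∨ y = 0
  · simp only [bMinus_eq_zero _ h, Nat.add_sub_cancel, Complex.ofReal_mul, Complex.ofReal_add,
      Complex.ofReal_pow, Complex.ofReal_zero]
    module
  · obtain ⟨y, rfl⟩ : ∃ y', y = y' + 1 := ⟨y - 1, by omega⟩
    obtain ⟨N, rfl⟩ : ∃ N', N = N' + 1 := ⟨N - 1, by omega⟩
    simp only [Nat.add_sub_cancel, adjoint_beta_ev q N x y (by omega) (by omega),
      Complex.ofReal_mul, Complex.ofReal_add, Complex.ofReal_pow,
      show N + 1 - 2 = N - 1 by omega]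
    module

theorem beta_adjoint_beta_ev (q : Set.Ioo (0 : ℝ) 1) {N x y : ℕ} (hx : x ≤ N) (hy : y ≤ N) :
    beta q (ContinuousLinearMap.adjoint (beta q) (ev N x y)) =
      ((bPlusStar q N x y ^ 2 + bMinus q (N + 1) x (y + 1) ^ 2 : ℝ) : ℂ) • ev N x y +
      ((bMinus q (N + 1) x (y + 1) * bPlus q (N + 1) x (y + 1) : ℝ) : ℂ) •
        ev (N + 2) (x + 1) (y + 1) +
      ((bPlusStar q N x y * bMinus q (N - 1) (x - 1) y : ℝ) : ℂ) •
        ev (N - 2) (x - 1) (y - 1) := by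
  rw [adjoint_beta_ev q N x y hx hy, map_add, map_smul, map_smul,
    beta_ev q (N + 1) x (y + 1) (by omega) (by omega)]
  by_cases h : N ≤ y ∨ x = 0
  · simp only [bPlusStar_eq_zero _ h, Nat.add_sub_cancel, Complex.ofReal_mul, Complex.ofReal_add,
      Complex.ofReal_pow, Complex.ofReal_zero]
    module
  · obtain ⟨x, rfl⟩ : ∃ x', x = x' + 1 := ⟨x - 1, by omega⟩
    obtain ⟨N, rfl⟩ : ∃ N', N = N' + 1 := ⟨N - 1, by omega⟩
    simp only [Nat.add_sub_cancel, beta_ev q N x y (by omega) (by omega),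
      Complex.ofReal_mul, Complex.ofReal_add, Complex.ofReal_pow, bPlusStar_succ (q : ℝ)
      (show y ≤ N by omega), show N + 1 - 2 = N - 1 by omega]
    module

/-- The operator `β` is normal. -/
theorem beta_mul_adjoint_beta (q : Set.Ioo (0 : ℝ) 1) :
    beta q * ContinuousLinearMap.adjoint (beta q) =
      ContinuousLinearMap.adjoint (beta q) * beta q := by
  refine clm_ext_e fun ⟨N, ⟨x, hx⟩, ⟨y, hy⟩⟩ => ?_
  have hx' := Nat.le_of_lt_succ hx
  have hy' := Nat.le_of_lt_succ hy
  rw [← ev_eq hx' hy', mul_apply_eq_comp, mul_apply_eq_comp,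
    adjoint_beta_beta_ev q hx' hy', beta_adjoint_beta_ev q hx' hy',
    diagonal_coeff_eq q.2.1 q.2.2 hx' hy', coeff_up_eq (q : ℝ) hx' hy']
  congr 3
  -- Only the downward coefficients remain; on the boundary of the index set both sides are 0.
  by_cases hx0 : x = 0
  · subst hx0
    simp [bPlusStar]
  by_cases hy0 : y = 0
  · subst hy0
    simp [bMinus]
  obtain ⟨x, rfl⟩ : ∃ x', x = x' + 1 := ⟨x - 1, by omega⟩
  obtain ⟨y, rfl⟩ : ∃ y', y = y' + 1 := ⟨y - 1, by omega⟩
  by_cases hxN : N = x + 1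
  · rw [bMinus_eq_zero _ (.inl hxN.le), bMinus_eq_zero (N := N - 1) _ (.inl (by omega))]
    simp
  by_cases hyN : N = y + 1
  · rw [bPlusStar_eq_zero _ (.inl hyN.le), bPlusStar_eq_zero (N := N - 1) _ (.inl (by omega))]
    simp
  obtain ⟨N, rfl⟩ : ∃ N', N = N' + 2 := ⟨N - 2, by omega⟩
  exact (coeff_down_eq (q : ℝ) (x := x) (y := y) (by omega) (by omega)).symm

/-! ### Matrix coefficients of (β*β)^r on the range of P. -/

/-- β*β does not preserve the range of P, but β does. Normality moves one β to each side of the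
inner product, which keeps the computation on that range. -/
theorem adjoint_mul_pow_succ (q : Set.Ioo (0 : ℝ) 1) (r : ℕ) :
    (ContinuousLinearMap.adjoint (beta q) * beta q) ^ (r + 1) =
      ContinuousLinearMap.adjoint (beta q) *
        (ContinuousLinearMap.adjoint (beta q) * beta q) ^ r * beta q := by
  rw [pow_succ, ← mul_assoc, mul_pow_mul, beta_mul_adjoint_beta]

/-- The diagonal matrix coefficients of `(β*β)^r` on the range of `P`. -/
theorem inner_pow_ev (q : Set.Ioo (0 : ℝ) 1) (r m y : ℕ) :
    inner ℂ (ev (m + y) (m + y) y)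
      (((ContinuousLinearMap.adjoint (beta q) * beta q) ^ r) (ev (m + y) (m + y) y)) =
      moment (((q : ℝ) : ℂ) ^ 2) r m y := by
  induction r generalizing m with
  | zero =>
    rw [ev_eq le_rfl (Nat.le_add_left y m), pow_zero, one_apply_eq_self, inner_e, e_apply,
      if_pos rfl]
    simp [moment]
  | succ r ih =>
    have hb : beta q (ev (m + y) (m + y) y) =
        ((bPlus q (m + y) (m + y) y : ℝ) : ℂ) • ev (m + 1 + y) (m + 1 + y) y := by
      rw [beta_ev q _ _ _ le_rfl (Nat.le_add_left y m), bMinus_eq_zero _ (.inl le_rfl),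
        show m + y + 1 = m + 1 + y by ring]
      simp
    have hne : 1 - (q : ℝ) ^ (2 * (m + y) + 2) ≠ 0 :=
      (sub_pos.mpr (pow_lt_one₀ q.2.1.le q.2.2 (by omega))).ne'
    have hsq : bPlus q (m + y) (m + y) y ^ 2 =
        ((q : ℝ) ^ 2) ^ y * (1 - ((q : ℝ) ^ 2) ^ (m + 1)) / (1 - ((q : ℝ) ^ 2) ^ (m + y + 2)) := by
      rw [bPlus_sq q.2.1 q.2.2, Nat.add_sub_cancel, ← mul_assoc,
        mul_comm (1 - (q : ℝ) ^ (2 * (m + y) + 2)), mul_div_mul_right _ _ hne, ← pow_mul, ← pow_mul,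
        ← pow_mul]
      ring_nf
    rw [adjoint_mul_pow_succ, mul_apply_eq_comp, mul_apply_eq_comp,
      ContinuousLinearMap.adjoint_inner_right, hb, map_smul, inner_smul_left, inner_smul_right,
      ih, moment_succ, Complex.conj_ofReal, ← mul_assoc, ← sq, ← Complex.ofReal_pow, hsq]
    push_cast
    rfl

/-! ### Trace class property and the trace as a sum over levels. -/

/-- The eigenvalue of `|D|` on the vectors with label `(N, x, y)`. -/
noncomputable def absEigen (ε : ℝ) (N : ℕ) : ℝ := if N = 0 then ε else N

theorem absEigen_pos {ε : ℝ} (hε : 0 < ε) (N : ℕ) : 0 < absEigen ε N := by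
  rw [absEigen]
  split_ifs with h
  · exact hε
  · exact_mod_cast Nat.pos_of_ne_zero h

theorem absDEigen_eq (ε : ℝ) (k : Idx) : absDEigen ε k = absEigen ε k.1 := by
  rw [absDEigen, absEigen, dEigen, fEigen]
  split_ifs <;> simp_all

theorem norm_absEigen_cpow {ε : ℝ} (hε : 0 < ε) (N : ℕ) (s : ℂ) :
    ‖(absEigen ε N : ℂ) ^ (-s)‖ = absEigen ε N ^ (-s.re) := by
  rw [Complex.norm_cpow_eq_rpow_re_of_pos (absEigen_pos hε N), Complex.neg_re]

theorem absDPow_e {ε : ℝ} (hε : 0 < ε) {s : ℂ} (hs : 0 ≤ s.re) (k : Idx) :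
    absDPow ε s (e k) = ((absEigen ε k.1 : ℂ) ^ (-s)) • e k := by
  rw [absDPow, diagOp_e, absDEigen_eq]
  refine ⟨max 1 (ε ^ (-s.re)), fun k => ?_⟩
  rw [absDEigen_eq, norm_absEigen_cpow hε, absEigen]
  split_ifs with h
  · exact le_max_right _ _
  · refine le_max_of_le_left (Real.rpow_le_one_of_one_le_of_nonpos ?_ (by linarith))
    exact_mod_cast Nat.one_le_iff_ne_zero.mpr h

theorem P_e (k : Idx) : P (e k) = (if (k.2.1 : ℕ) = k.1 then 1 else 0 : ℂ) • e k := by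
  have hF : F (e k) = (fEigen k : ℂ) • e k := by
    refine diagOp_e _ ⟨1, fun k => ?_⟩ k
    rw [fEigen]
    split_ifs <;> simp
  rw [P, _root_.smul_apply, _root_.add_apply, one_apply_eq_self, hF, fEigen]
  split_ifs
  · push_cast
    module
  · push_cast
    module

theorem summable_sq_mul_absEigen_rpow {ε σ : ℝ} (hε : 0 < ε) (hσ : 3 < σ) :
    Summable fun N : ℕ => ((N : ℝ) + 1) ^ 2 * absEigen ε N ^ (-σ) := by
  rw [← summable_nat_add_iff 1]
  -- (N + 2)² ≤ 4 (N + 1)²; level N has (N + 1)² basis vectors, whence the bound σ > 3.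
  have h : Summable fun N : ℕ => 4 * ((N + 1 : ℕ) : ℝ) ^ (2 - σ) :=
    ((summable_nat_add_iff 1).mpr (Real.summable_nat_rpow.mpr (by linarith))).mul_left 4
  refine Summable.of_nonneg_of_le
    (fun N => mul_nonneg (sq_nonneg _) (Real.rpow_nonneg (absEigen_pos hε _).le _))
    (fun N => ?_) h
  have hN : (0 : ℝ) < ((N + 1 : ℕ) : ℝ) := by positivity
  have h1 : (1 : ℝ) ≤ ((N + 1 : ℕ) : ℝ) := by exact_mod_cast Nat.le_add_left 1 N
  rw [absEigen, if_neg (Nat.succ_ne_zero N), sub_eq_add_neg, Real.rpow_add hN, ← mul_assoc,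
    Real.rpow_ofNat]
  refine mul_le_mul_of_nonneg_right ?_ (by positivity)
  nlinarith

theorem summable_absEigen_rpow {ε σ : ℝ} (hε : 0 < ε) (hσ : 3 < σ) :
    Summable fun k : Idx => absEigen ε k.1 ^ (-σ) := by
  refine (summable_sigma_of_nonneg fun k => Real.rpow_nonneg (absEigen_pos hε _).le _).mpr
    ⟨fun N => Summable.of_finite, ?_⟩
  refine (summable_sq_mul_absEigen_rpow hε hσ).congr fun N => ?_
  simp only [tsum_fintype, Finset.sum_const, Finset.card_univ, Fintype.card_prod,
    Fintype.card_fin, nsmul_eq_mul]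
  push_cast
  ring

theorem isHilbertSchmidt_mul_absDPow {ε : ℝ} (hε : 0 < ε) (a : H →L[ℂ] H) {s : ℂ}
    (hs : 3 < 2 * s.re) : IsHilbertSchmidt (a * absDPow ε s) := by
  refine Summable.of_nonneg_of_le (fun k => sq_nonneg _) (fun k => ?_)
    ((summable_absEigen_rpow hε hs).mul_left (‖a‖ ^ 2))
  have he : ‖e k‖ = 1 := by simp [e, lp.norm_single]
  rw [mul_apply_eq_comp, absDPow_e hε (by linarith), map_smul, norm_smul, norm_absEigen_cpow hε,
    mul_pow, mul_comm, ← Real.rpow_mul_natCast (absEigen_pos hε _).le]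
  refine mul_le_mul ?_ (le_of_eq ?_) (Real.rpow_nonneg (absEigen_pos hε _).le _) (by positivity)
  · have := a.le_opNorm (e k)
    rw [he, mul_one] at this
    gcongr
  · congr 1
    push_cast
    ring

/-- Split |D|^(-s) into two copies of |D|^(-s/2), each Hilbert-Schmidt as Re s > 3. -/
theorem isTraceClass_mul_absDPow {ε : ℝ} (hε : 0 < ε) (a : H →L[ℂ] H) {s : ℂ}
    (hs : 3 < s.re) : IsTraceClass (a * absDPow ε s) := by
  have h2 : 3 < 2 * (s / 2).re := by
    rw [Complex.div_ofNat_re]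
    linarith
  refine ⟨a * absDPow ε (s / 2), 1 * absDPow ε (s / 2), isHilbertSchmidt_mul_absDPow hε a h2,
    isHilbertSchmidt_mul_absDPow hε 1 h2, ?_⟩
  rw [one_mul, mul_assoc]
  congr 1
  refine clm_ext_e fun k => ?_
  have hne : (absEigen ε k.1 : ℂ) ≠ 0 := by exact_mod_cast (absEigen_pos hε _).ne'
  rw [mul_apply_eq_comp, absDPow_e hε (by linarith), absDPow_e hε (by linarith), map_smul,
    absDPow_e hε (by linarith), smul_smul, ← Complex.cpow_add _ _ hne]
  congr 2
  ring

theorem inner_mul_P_mul_absDPow {ε : ℝ} (hε : 0 < ε) (a : H →L[ℂ] H) {s : ℂ} (hs : 3 < s.re)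
    (k : Idx) : inner ℂ (e k) ((a * P * absDPow ε s) (e k)) =
      if (k.2.1 : ℕ) = k.1 then (absEigen ε k.1 : ℂ) ^ (-s) * inner ℂ (e k) (a (e k)) else 0 := by
  rw [mul_apply_eq_comp, mul_apply_eq_comp, absDPow_e hε (by linarith), map_smul, P_e, map_smul,
    map_smul, inner_smul_right, inner_smul_right]
  split_ifs <;> simp

/-- The sum of the diagonal matrix coefficients of `a` over the vectors `e_{nj}^{(n)}`,
`N = 2n`. -/
noncomputable def levelTrace (a : H →L[ℂ] H) (N : ℕ) : ℂ :=
  ∑ y ∈ Finset.range (N + 1), inner ℂ (ev N N y) (a (ev N N y))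

theorem hasSum_trace {ε : ℝ} (hε : 0 < ε) (a : H →L[ℂ] H) {s : ℂ} (hs : 3 < s.re) :
    HasSum (fun N => (absEigen ε N : ℂ) ^ (-s) * levelTrace a N)
      (trace (a * P * absDPow ε s)) := by
  have hsum : Summable fun k => inner ℂ (e k) ((a * P * absDPow ε s) (e k)) := by
    refine Summable.of_norm_bounded ((summable_absEigen_rpow hε hs).mul_left ‖a‖) fun k => ?_
    have he : ‖e k‖ = 1 := by simp [e, lp.norm_single]
    have hn : ‖inner ℂ (e k) (a (e k))‖ ≤ ‖a‖ := by
      refine (norm_inner_le_norm _ _).trans ?_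
      have := a.le_opNorm (e k)
      rw [he, mul_one] at this
      rwa [he, one_mul]
    rw [inner_mul_P_mul_absDPow hε a hs]
    split_ifs
    · rw [norm_mul, norm_absEigen_cpow hε, mul_comm]
      exact mul_le_mul_of_nonneg_right hn (Real.rpow_nonneg (absEigen_pos hε _).le _)
    · rw [norm_zero]
      exact mul_nonneg (norm_nonneg _) (Real.rpow_nonneg (absEigen_pos hε _).le _)
  have hfun : (fun N => (absEigen ε N : ℂ) ^ (-s) * levelTrace a N) = fun N =>
      ∑ c : Fin (N + 1) × Fin (N + 1), inner ℂ (e ⟨N, c⟩) ((a * P * absDPow ε s) (e ⟨N, c⟩)) := by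
    funext N
    rw [levelTrace, Finset.sum_range, Finset.mul_sum, Fintype.sum_prod_type_right]
    refine Finset.sum_congr rfl fun y _ => ?_
    rw [Finset.sum_eq_single (Fin.last N)]
    · rw [inner_mul_P_mul_absDPow hε a hs, if_pos (Fin.val_last N),
        ev_eq le_rfl (Nat.le_of_lt_succ y.2)]
      rfl
    · intro x _ hx
      rw [inner_mul_P_mul_absDPow hε a hs]
      exact if_neg fun h => hx (Fin.ext h)
    · exact fun h => absurd (Finset.mem_univ _) h
  rw [hfun]
  exact hsum.hasSum.sigma fun N => hasSum_fintype _

theorem levelTrace_pow (q : Set.Ioo (0 : ℝ) 1) (r N : ℕ) :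
    levelTrace ((ContinuousLinearMap.adjoint (beta q) * beta q) ^ r) N =
      momentSum (((q : ℝ) : ℂ) ^ 2) r N := by
  refine Finset.sum_congr rfl fun y hy => ?_
  obtain ⟨m, rfl⟩ : ∃ m, N = m + y := ⟨N - y, by have := Finset.mem_range.mp hy; omega⟩
  rw [inner_pow_ev, Nat.add_sub_cancel]

/-! ### Meromorphic continuation and its value at 0. -/

/-- The meromorphic continuation of the zeta function attached to a sequence of level traces
with limit `K` and deviations `d` from it. -/
noncomputable def zetaContinuation (ε : ℝ) (K : ℂ) (d : ℕ → ℂ) (s : ℂ) : ℂ :=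
  (K + d 0) * (ε : ℂ) ^ (-s) + K * riemannZeta s + LSeries d s

theorem isEtaZeta_zetaContinuation {ε : ℝ} (hε : 0 < ε) {a : H →L[ℂ] H} {K : ℂ} {d : ℕ → ℂ}
    (hd : ∀ s, LSeriesSummable d s) (han : ∀ s, AnalyticAt ℂ (LSeries d) s)
    (ha : ∀ N, levelTrace a N = K + d N) : IsEtaZeta ε a (zetaContinuation ε K d) := by
  have hε0 : (ε : ℂ) ≠ 0 := by exact_mod_cast hε.ne'
  have hpow : ∀ s, AnalyticAt ℂ (fun s : ℂ => (ε : ℂ) ^ (-s)) s := fun s =>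
    (show Differentiable ℂ (fun s : ℂ => (ε : ℂ) ^ (-s)) from
      fun s => (differentiableAt_id.neg).const_cpow (.inl hε0)).analyticAt s
  constructor
  · intro s
    exact (((analyticAt_const.mul (hpow s)).meromorphicAt).add
      ((MeromorphicAt.const K s).mul (meromorphic_riemannZeta s))).add (han s).meromorphicAt
  · exact ((analyticAt_const.mul (hpow 0)).add (analyticAt_const.mul
      (analyticOn_riemannZeta 0 (by simp)))).add (han 0)
  · exact fun s hs => isTraceClass_mul_absDPow hε _ hs
  · intro s hs
    refine HasSum.unique ?_ (hasSum_trace hε a hs)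
    -- The terms of an `LSeries` at index 0 are 0, so the kernel of D, where |D| is ε, is added by
    -- hand.
    have h1 : HasSum (fun N => if N = 0 then (K + d 0) * (ε : ℂ) ^ (-s) else 0)
        ((K + d 0) * (ε : ℂ) ^ (-s)) := hasSum_ite_eq 0 _
    have h2 : HasSum (fun N => K * LSeries.term 1 s N) (K * riemannZeta s) :=
      (LSeriesHasSum_one (by linarith)).mul_left K
    have hfun : (fun N => (absEigen ε N : ℂ) ^ (-s) * levelTrace a N) = fun N =>
        ((if N = 0 then (K + d 0) * (ε : ℂ) ^ (-s) else 0) + K * LSeries.term 1 s N) +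
          LSeries.term d s N := by
      funext N
      rw [ha]
      rcases Nat.eq_zero_or_pos N with rfl | hN
      · simp [absEigen, mul_comm]
      · rw [LSeries.term_of_ne_zero hN.ne', LSeries.term_of_ne_zero hN.ne', absEigen,
          if_neg hN.ne', if_neg hN.ne', Complex.cpow_neg, Complex.ofReal_natCast, Pi.one_apply]
        ring
    rw [hfun]
    exact (h1.add h2).add (hd s).LSeriesHasSum

/-- The level N = 0 contributes K + d(0), and ζ(0) = -1/2 turns K into K/2. -/
theorem zetaContinuation_zero (ε : ℝ) (K : ℂ) {d : ℕ → ℂ} (hd : Summable d) :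
    zetaContinuation ε K d 0 = 1 / 2 * K + ∑' N, d N := by
  have hL : LSeries d 0 = ∑' N, d (N + 1) := by
    have hs : Summable (LSeries.term d 0) := by
      rw [← summable_nat_add_iff 1]
      refine ((summable_nat_add_iff 1).mpr hd).congr fun N => ?_
      simp [LSeries.term]
    rw [LSeries, hs.tsum_eq_zero_add, LSeries.term_zero, zero_add]
    exact tsum_congr fun N => by simp [LSeries.term]
  rw [zetaContinuation, hL, riemannZeta_zero, hd.tsum_eq_zero_add, neg_zero, Complex.cpow_zero]
  ring

end SUq2

theorem theorem6 :
    (∀ τ : ℂ, 0 < τ.im →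
      logDeriv ModularForm.eta τ =
        2 * Real.pi * Complex.I *
          (1 / 24 - SUq2.G (Complex.exp (2 * Real.pi * Complex.I * τ)))) ∧
    ∀ r : ℕ, 1 ≤ r →
      ∃ R : RatFunc ℂ,
        (∀ z : ℂ, R.denom.eval z = 0 → ∃ k : ℕ, 0 < k ∧ z ^ k = 1) ∧
        ∀ (q : Set.Ioo (0 : ℝ) 1) (ε : ℝ), 0 < ε →
          (∃ Z : ℂ → ℂ, SUq2.IsEtaZeta ε
            ((ContinuousLinearMap.adjoint (SUq2.beta q) * SUq2.beta q) ^ r) Z) ∧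
          (1 / 2 : ℂ) * SUq2.psi0 ε
              ((ContinuousLinearMap.adjoint (SUq2.beta q) * SUq2.beta q) ^ r) =
            (((q : ℝ) : ℂ) ^ (2 * r))⁻¹ *
              (((q : ℝ) : ℂ) ^ 2 * R.eval (RingHom.id ℂ) (((q : ℝ) : ℂ) ^ 2)
                - SUq2.G (((q : ℝ) : ℂ) ^ 2)) := by
  refine ⟨ModularForm.logDeriv_eta_eq_lambert, fun r hr => ?_⟩
  obtain ⟨R, hR, hRe⟩ := SUq2.exists_ratFunc_regularizedSum hr
  refine ⟨R, hR, fun q ε hε => ?_⟩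
  have hx0 : ((q : ℝ) : ℂ) ^ 2 ≠ 0 := pow_ne_zero 2 (by exact_mod_cast q.2.1.ne')
  have hx : ‖((q : ℝ) : ℂ) ^ 2‖ < 1 := by
    rw [norm_pow, Complex.norm_real, Real.norm_of_nonneg q.2.1.le]
    exact pow_lt_one₀ q.2.1.le q.2.2 two_ne_zero
  have hZ := SUq2.isEtaZeta_zetaContinuation (K := 1 / (1 - (((q : ℝ) : ℂ) ^ 2) ^ r)) hε
    (SUq2.lseriesSummable_deviation hx0 hx hr) (SUq2.analyticAt_lseries_deviation hx0 hx hr)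
    (fun N => by rw [SUq2.levelTrace_pow, SUq2.deviation, add_sub_cancel])
  refine ⟨⟨_, hZ⟩, ?_⟩
  rw [SUq2.psi0_eq hZ, SUq2.zetaContinuation_zero ε _ (SUq2.summable_deviation hx0 hx hr),
    ← SUq2.regularizedSum, ← hRe _ hx0 hx, pow_mul, inv_mul_cancel_left₀ (pow_ne_zero r hx0)]
  ring
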